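/- Let $T$ be a finite simple tree on $n\ge 6$ vertices. A pendant vertex is a vertex of degree $1$, and a quasi-pendant vertex is a vertex adjacent to a pendant vertex. Suppose that $T$ is reduced, i.e. the number of pendant vertices of $T$ equals the number of quasi-pendant vertices of $T$, and that $T$ has no pendant path $P_3$, i.e. $T$ cannot be obtained from a graph $G_1$ and a disjoint path $P_3$ on three vertices by joining an end vertex of $P_3$ to a vertex of $G_1$. Let $m_{L(T)}(1)$ be the multiplicity of $1$ as an eigenvalue of the Laplacian matrix $L(T)=D(T)-A(T)$ (zero if $1$ is not an eigenvalue). Then $$m_{L(T)}(1)\le \frac{n-6}{4},$$ and equality holds if and only if, for some integer $k\ge 1$, $T$ is isomorphic to the tree on $4k+2$ vertices obtained from a path $x_1x_2\cdots x_{3k+2}$ by attaching one new pendant vertex to each of the vertices $x_3,x_6,\dots,x_{3k}$. -/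

import Mathlib

/-- The number `p(G)` of pendant vertices (vertices of degree one). -/
def pendantCount {V : Type*} [Fintype V] (G : SimpleGraph V) [DecidableRel G.Adj] : ℕ :=
  (Finset.univ.filter fun v => G.degree v = 1).card

/-- The number `q(G)` of quasi-pendant vertices (vertices adjacent to a pendant vertex). -/
def quasiPendantCount {V : Type*} [Fintype V] (G : SimpleGraph V) [DecidableRel G.Adj] : ℕ :=
  (Finset.univ.filter fun v => ∃ u, G.Adj u v ∧ G.degree u = 1).card

/-- A graph is reduced if `p(G) = q(G)`. -/
def IsReducedGraph {V : Type*} [Fintype V] (G : SimpleGraph V) [DecidableRel G.Adj] : Prop :=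
  pendantCount G = quasiPendantCount G

/-- `G` has a pendant path `P_k`: there is an induced path `p 0, …, p (k - 1)` in `G`, and a vertex
`w` off the path, such that the only edge between the path and the rest of `G` joins the end vertex
`p 0` to `w`. Equivalently `G` arises from a graph `G₁` and a disjoint `P_k` by joining an end
vertex of `P_k` to a vertex of `G₁`. -/
def HasPendantPath {V : Type*} (G : SimpleGraph V) (k : ℕ) [NeZero k] : Prop :=
  ∃ p : SimpleGraph.pathGraph k ↪g G, ∃ w, w ∉ Set.range p ∧
    ∀ (i : Fin k) (x : V), x ∉ Set.range p → (G.Adj (p i) x ↔ i = 0 ∧ x = w)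

/-- The multiplicity of the real number `μ` as an eigenvalue of the Laplacian matrix of `G`
(zero if `μ` is not an eigenvalue). -/
noncomputable def laplacianMultiplicity {V : Type*} [Fintype V] [DecidableEq V]
    (G : SimpleGraph V) [DecidableRel G.Adj] (μ : ℝ) : ℕ :=
  (G.lapMatrix ℝ).charpoly.rootMultiplicity μ

/-- Adjacency in the extremal tree: the spine is the path on the vertices `0, …, 3k + 1`, and the
extra vertex number `i < k` is adjacent exactly to the spine vertex `3i + 2`. -/
def extremalTreeAdj (k : ℕ) : Fin (3 * k + 2) ⊕ Fin k → Fin (3 * k + 2) ⊕ Fin k → Prop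
  | .inl a, .inl b => (SimpleGraph.pathGraph (3 * k + 2)).Adj a b
  | .inl a, .inr i => a.val = 3 * i.val + 2
  | .inr i, .inl a => a.val = 3 * i.val + 2
  | .inr _, .inr _ => False

/-- The extremal tree on `4k + 2` vertices: a path `x₁ x₂ … x_{3k+2}` with one pendant vertex
attached to each of `x₃, x₆, …, x_{3k}`. -/
def extremalTree (k : ℕ) : SimpleGraph (Fin (3 * k + 2) ⊕ Fin k) where
  Adj := extremalTreeAdj k
  symm := ⟨by
    rintro (a | i) (b | j) h
    · exact SimpleGraph.Adj.symm (G := SimpleGraph.pathGraph (3 * k + 2)) h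
    · exact h
    · exact h
    · exact h⟩
  loopless := ⟨by
    rintro (a | i) h
    · exact SimpleGraph.irrefl (SimpleGraph.pathGraph (3 * k + 2)) h
    · exact h⟩

/-! Call a vertex inner if it is neither pendant nor quasi-pendant. In a reduced tree every
quasi-pendant vertex has exactly one pendant neighbour, so $n = 2\,\#\text{quasi-pendant} +
\#\text{inner}$.

The equation at a pendant vertex makes an eigenvector for 1 vanish at its neighbour, so only inner
values matter. Root $T$ at a pendant vertex `r` whose neighbour `q` has degree 2; since there is no
pendant $P_3$, the child `w` of `q` has degree at least 3. Working up from the leaves, an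
eigenvector is determined by its values at inner parents of bottom vertices, where a bottom vertex
is an inner vertex with only quasi-pendant children. Choosing one hanging quasi-pendant grandchild
for each such parent gives a set `U` with $m\le|U|$ (`eq_zero_of_vanish_on_transversal`). The
parents and grandparents of `U` are $2|U|$ distinct inner vertices, and `U` misses at least three
quasi-pendant vertices: `q` and two more found by following deepest branches (`card_add_three_le`).
Hence $n\ge 2(|U|+3)+2|U|\ge 4m+6$.

Equality makes all these counts sharp. Eigenvectors then take arbitrary values on the grandparents
of `U`, which forces every inner degree to be 2 (`degree_par`). Each nonpendant vertex but one then
has a nonpendant child, so by counting the nonpendant vertices form a path, along which the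
quasi-pendant ones recur with period 3. Conversely, the extremal tree carries an explicit
$(k-1)$-dimensional space of eigenvectors. -/

/-! ### The Laplacian eigenspace at 1 -/

/-- The algebraic multiplicity of a Laplacian eigenvalue is the dimension of its eigenspace. -/
theorem laplacianMultiplicity_eq_finrank {V : Type*} [Fintype V] [DecidableEq V]
    (G : SimpleGraph V) [DecidableRel G.Adj] (μ : ℝ) :
    laplacianMultiplicity G μ =
      Module.finrank ℝ (Module.End.eigenspace (Matrix.toLin' (G.lapMatrix ℝ)) μ) := by
  set A := G.lapMatrix ℝ with hA
  have hsym : (Matrix.toEuclideanLin A).IsSymmetric :=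
    Matrix.isSymmetric_toEuclideanLin_iff.2 (G.isHermitian_lapMatrix ℝ)
  have hss := hsym.isFinitelySemisimple
  have h1 := LinearMap.finrank_maxGenEigenspace_eq (Matrix.toEuclideanLin A) μ
  rw [hss.maxGenEigenspace_eq_eigenspace] at h1
  have h2 : (Matrix.toEuclideanLin A).charpoly = A.charpoly := by
    rw [Matrix.toEuclideanLin_eq_toLin_orthonormal, Matrix.charpoly_toLin]
  rw [laplacianMultiplicity, ← hA, ← h2, ← h1]
  refine LinearEquiv.finrank_eq ?_
  refine LinearEquiv.ofSubmodules (WithLp.linearEquiv 2 ℝ (V → ℝ)) _ _ ?_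
  ext x
  simp only [Submodule.mem_map, Module.End.mem_eigenspace_iff]
  constructor
  · rintro ⟨y, hy, rfl⟩
    simpa using congrArg (WithLp.linearEquiv 2 ℝ (V → ℝ)) hy
  · intro hx
    refine ⟨WithLp.toLp 2 x, ?_, by simp⟩
    simpa using congrArg (WithLp.toLp 2) hx

/-- The equations defining the eigenspace of the Laplacian at `1`. -/
theorem mem_eigenspace_lapMatrix_one {V : Type*} [Fintype V] [DecidableEq V]
    {G : SimpleGraph V} [DecidableRel G.Adj] {x : V → ℝ} :
    x ∈ Module.End.eigenspace (Matrix.toLin' (G.lapMatrix ℝ)) 1 ↔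
      ∀ v, ((G.degree v : ℝ) - 1) * x v = ∑ u ∈ G.neighborFinset v, x u := by
  rw [Module.End.mem_eigenspace_iff, Matrix.toLin'_apply, funext_iff]
  refine forall_congr' fun v => ?_
  rw [G.lapMatrix_mulVec_apply, one_smul]
  constructor <;> intro h <;> linarith

/-! ### Rooted trees: parents and depths -/

namespace SimpleGraph

variable {V : Type*}

/-- `par` and `d` are the parent function and the depth function of the tree `T` rooted at `r`. -/
structure IsRooting (T : SimpleGraph V) (r : V) (par : V → V) (d : V → ℕ) : Prop where
  depth_root : d r = 0
  depth_par : ∀ v, v ≠ r → d (par v) + 1 = d v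
  adj_iff : ∀ u v, T.Adj u v ↔ (u ≠ r ∧ par u = v) ∨ (v ≠ r ∧ par v = u)

/-- Depth is the distance to `r`. Two neighbours closer to `r` would start two different paths to
`r`, so the parent is unique; adjacent vertices in a tree never have equal depth, so every edge
joins a child to its parent. -/
theorem IsTree.exists_isRooting {T : SimpleGraph V} (hT : T.IsTree) (r : V) :
    ∃ par d, T.IsRooting r par d := by
  have hex : ∀ v, v ≠ r → ∃ u, T.Adj u v ∧ T.dist r u + 1 = T.dist r v := by
    intro v hv
    obtain ⟨p, hp, hl⟩ := hT.connected.exists_path_of_dist v r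
    have hnil : ¬ p.Nil := SimpleGraph.Walk.not_nil_of_ne hv
    refine ⟨p.snd, (p.adj_snd hnil).symm, ?_⟩
    have h1 := SimpleGraph.dist_le p.tail
    have h2 := SimpleGraph.Walk.length_tail_add_one hnil
    have h3 := hT.dist_eq_dist_add_one_of_adj r (p.adj_snd hnil)
    rw [T.dist_comm (u := r), T.dist_comm (u := r)] at *
    omega
  choose! par hpar hd using hex
  have key : ∀ u v, T.Adj u v → T.dist r v = T.dist r u + 1 → v ≠ r ∧ par v = u := by
    intro u v h hduv
    have hv : v ≠ r := by
      rintro rfl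
      simp at hduv
    refine ⟨hv, ?_⟩
    obtain ⟨p, hp, hl⟩ := hT.connected.exists_path_of_dist (par v) r
    obtain ⟨q, hq, hl'⟩ := hT.connected.exists_path_of_dist u r
    have h1 := hd v hv
    have hp' : (SimpleGraph.Walk.cons (hpar v hv).symm p).IsPath := by
      apply SimpleGraph.Walk.isPath_of_length_eq_dist
      rw [SimpleGraph.Walk.length_cons, hl, T.dist_comm, T.dist_comm (u := v)]
      exact h1
    have hq' : (SimpleGraph.Walk.cons h.symm q).IsPath := by
      apply SimpleGraph.Walk.isPath_of_length_eq_dist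
      rw [SimpleGraph.Walk.length_cons, hl', T.dist_comm, T.dist_comm (u := v)]
      exact hduv.symm
    have := congrArg SimpleGraph.Walk.snd ((hT.existsUnique_path v r).unique hp' hq')
    simpa using this
  refine ⟨par, T.dist r, T.dist_self, hd, fun u v => ⟨fun h => ?_, ?_⟩⟩
  · rcases hT.dist_eq_dist_add_one_of_adj r h with h' | h'
    · exact Or.inl (key v u h.symm h')
    · exact Or.inr (key u v h h')
  · rintro (⟨h, rfl⟩ | ⟨h, rfl⟩)
    · exact (hpar u h).symm
    · exact hpar v h

namespace IsRooting

variable {T : SimpleGraph V} {r : V} {par : V → V} {d : V → ℕ} (h : T.IsRooting r par d)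
include h
theorem adj_par {v : V} (hv : v ≠ r) : T.Adj v (par v) := (h.adj_iff _ _).2 (Or.inl ⟨hv, rfl⟩)

theorem eq_root_of_depth_eq_zero {v : V} (hv : d v = 0) : v = r := by
  by_contra hne
  have := h.depth_par v hne
  omega

theorem ne_root_of_depth_pos {v : V} (hv : 0 < d v) : v ≠ r := by
  rintro rfl
  have := h.depth_root
  omega

theorem depth_pos {v : V} (hv : v ≠ r) : 0 < d v := by
  have := h.depth_par v hv
  omega

/-- The bound on `k` matters: `par r` is unconstrained, so iterates past the root carry no
information. -/
theorem depth_iterate {v : V} {k : ℕ} (hk : k ≤ d v) : d (par^[k] v) + k = d v := by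
  induction k with
  | zero => simp
  | succ k ih =>
    have h1 := ih (by omega)
    rw [Function.iterate_succ_apply']
    have := h.depth_par (par^[k] v) (h.ne_root_of_depth_pos (by omega))
    omega

/-- A neighbour of `v` other than its parent is a child of `v`. -/
theorem child_of_adj {u v : V} (huv : T.Adj u v) (hne : v = r ∨ u ≠ par v) :
    u ≠ r ∧ par u = v := by
  rcases (h.adj_iff u v).1 huv with h1 | h1
  · exact h1
  · rcases hne with rfl | hne
    · exact absurd rfl h1.1
    · exact absurd h1.2.symm hne

end IsRooting

end SimpleGraph

/-! ### Local structure of reduced trees without pendant $P_3$ -/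

namespace SimpleGraph

variable {V : Type*}

/-- A nonempty set closed under adjacency contains a whole component. This rules out trees on two or
three vertices below. -/
theorem Connected.card_le_of_forall_adj_mem [Fintype V] {G : SimpleGraph V} (hG : G.Connected)
    (s : Finset V) {a : V} (ha : a ∈ s) (hs : ∀ u ∈ s, ∀ v, G.Adj u v → v ∈ s) :
    Fintype.card V ≤ s.card := by
  have key : ∀ u v, G.Walk u v → u ∈ s → v ∈ s := by
    intro u v p
    induction p with
    | nil => exact id
    | cons hadj _ ih => exact fun hu => ih (hs _ hu _ hadj)
  have : s = Finset.univ := by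
    rw [Finset.eq_univ_iff_forall]
    intro v
    obtain ⟨p⟩ := hG.preconnected a v
    exact key a v p ha
  rw [this, Finset.card_univ]

section Degree

variable [Fintype V] {G : SimpleGraph V} [DecidableRel G.Adj]

theorem exists_adj_notMem_of_card_lt_degree {v : V} (s : Finset V) (hs : s.card < G.degree v) :
    ∃ y, G.Adj v y ∧ y ∉ s := by
  obtain ⟨y, hy, hys⟩ := Finset.exists_mem_notMem_of_card_lt_card hs
  exact ⟨y, (G.mem_neighborFinset v y).1 hy, hys⟩

theorem eq_of_degree_eq_one {v a b : V} (hv : G.degree v = 1) (ha : G.Adj v a) (hb : G.Adj v b) :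
    a = b :=
  (degree_eq_one_iff_existsUnique_adj.1 hv).unique ha hb

theorem neighborFinset_eq_pair [DecidableEq V] {v a b : V} (hv : G.degree v = 2) (ha : G.Adj v a) (hb : G.Adj v b)
    (hab : a ≠ b) : G.neighborFinset v = {a, b} := by
  symm
  apply Finset.eq_of_subset_of_card_le
  · simp [Finset.insert_subset_iff, ha, hb]
  · rw [Finset.card_pair hab]
    exact hv.le

theorem eq_or_eq_of_degree_eq_two {v a b c : V} (hv : G.degree v = 2) (ha : G.Adj v a)
    (hb : G.Adj v b) (hab : a ≠ b) (hc : G.Adj v c) : c = a ∨ c = b := by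
  classical
  have := (G.mem_neighborFinset v c).2 hc
  rw [neighborFinset_eq_pair hv ha hb hab] at this
  simpa using this

theorem degree_le_of_forall_adj_mem {v : V} (s : Finset V) (hs : ∀ u, G.Adj v u → u ∈ s) :
    G.degree v ≤ s.card :=
  Finset.card_le_card fun u hu => hs u ((G.mem_neighborFinset v u).1 hu)

end Degree

variable [Fintype V] (T : SimpleGraph V) [DecidableRel T.Adj]

/-- `v` is adjacent to a pendant vertex. -/
def IsQuasiPendant (v : V) : Prop := ∃ u, T.Adj u v ∧ T.degree u = 1

/-- `v` is neither pendant nor quasi-pendant. -/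
def IsInner (v : V) : Prop := T.degree v ≠ 1 ∧ ¬ T.IsQuasiPendant v

instance : DecidablePred T.IsQuasiPendant := fun v =>
  inferInstanceAs (Decidable (∃ u, T.Adj u v ∧ T.degree u = 1))

instance : DecidablePred T.IsInner := fun v =>
  inferInstanceAs (Decidable (T.degree v ≠ 1 ∧ ¬ T.IsQuasiPendant v))

/-- The local degree conditions satisfied by a large reduced tree without pendant `P₃`. -/
structure PendantSparse : Prop where
  degree_pos : ∀ v, 0 < T.degree v
  degree_ne_one : ∀ u v, T.Adj u v → T.degree u = 1 → T.degree v ≠ 1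
  pendant_unique : ∀ q u v, T.Adj u q → T.Adj v q → T.degree u = 1 → T.degree v = 1 → u = v
  three_le_degree : ∀ p q w, T.Adj p q → T.degree p = 1 → T.degree q = 2 → T.Adj q w → w ≠ p →
    3 ≤ T.degree w

variable {T}

namespace IsQuasiPendant

theorem degree_ne_one (hs : T.PendantSparse) {q : V} (hq : T.IsQuasiPendant q) :
    T.degree q ≠ 1 := by
  obtain ⟨p, hp, hp1⟩ := hq
  exact hs.degree_ne_one p q hp hp1

theorem two_le_degree (hs : T.PendantSparse) {q : V} (hq : T.IsQuasiPendant q) :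
    2 ≤ T.degree q := by
  have := hs.degree_pos q
  have := hq.degree_ne_one hs
  omega

end IsQuasiPendant

theorem IsInner.two_le_degree (hs : T.PendantSparse) {v : V} (hv : T.IsInner v) :
    2 ≤ T.degree v := by
  have := hs.degree_pos v
  have := hv.1
  omega

theorem IsInner.degree_ne_one_of_adj {v u : V} (hv : T.IsInner v) (h : T.Adj u v) :
    T.degree u ≠ 1 := fun hu => hv.2 ⟨u, h, hu⟩

theorem isInner_or_isQuasiPendant {v : V} (hv : T.degree v ≠ 1) :
    T.IsInner v ∨ T.IsQuasiPendant v := by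
  by_cases h : T.IsQuasiPendant v
  · exact Or.inr h
  · exact Or.inl ⟨hv, h⟩

/-- The unique-neighbour map identifies pendant vertices with quasi-pendant vertices in a reduced
graph. -/
theorem pendant_unique_of_isReducedGraph (hred : IsReducedGraph T) {q u v : V}
    (hu : T.Adj u q) (hv : T.Adj v q) (hu1 : T.degree u = 1) (hv1 : T.degree v = 1) : u = v := by
  classical
  have hex : ∀ u, T.degree u = 1 → ∃ w, T.Adj u w := fun u hu =>
    (degree_eq_one_iff_existsUnique_adj.1 hu).exists
  choose! f hf using hex
  have huniq : ∀ u w, T.degree u = 1 → T.Adj u w → f u = w := fun u w h1 h2 =>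
    (degree_eq_one_iff_existsUnique_adj.1 h1).unique (hf u h1) h2
  have himg : (Finset.univ.filter fun v => ∃ u, T.Adj u v ∧ T.degree u = 1) =
      (Finset.univ.filter fun v => T.degree v = 1).image f := by
    ext w
    simp only [Finset.mem_filter, Finset.mem_univ, true_and, Finset.mem_image]
    constructor
    · rintro ⟨u, h1, h2⟩
      exact ⟨u, h2, huniq u w h2 h1⟩
    · rintro ⟨u, h1, rfl⟩
      exact ⟨u, hf u h1, h1⟩
  have hinj : Set.InjOn f (Finset.univ.filter fun v => T.degree v = 1 : Finset V) := by
    rw [← Finset.card_image_iff, ← himg]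
    exact hred.symm
  refine hinj (by simpa using hu1) (by simpa using hv1) ?_
  rw [huniq u q hu1 hu, huniq v q hv1 hv]

theorem card_eq_of_isReducedGraph (hs : T.PendantSparse) (hred : IsReducedGraph T) :
    Fintype.card V = 2 * (Finset.univ.filter T.IsQuasiPendant).card +
      (Finset.univ.filter T.IsInner).card := by
  classical
  have h1 : (Finset.univ.filter fun v => T.degree v = 1).card =
      (Finset.univ.filter T.IsQuasiPendant).card := hred
  have h2 := Finset.card_filter_add_card_filter_not (s := Finset.univ) (fun v => T.degree v = 1)
  have h3 := Finset.card_filter_add_card_filter_not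
    (s := Finset.univ.filter fun v => ¬ T.degree v = 1) T.IsQuasiPendant
  rw [Finset.filter_filter, Finset.filter_filter] at h3
  have h4 : (Finset.univ.filter fun v => ¬ T.degree v = 1 ∧ T.IsQuasiPendant v) =
      Finset.univ.filter T.IsQuasiPendant :=
    Finset.filter_congr fun v _ => ⟨fun h => h.2, fun h => ⟨h.degree_ne_one hs, h⟩⟩
  rw [h4] at h3
  rw [Finset.card_univ] at h2
  change _ + (Finset.univ.filter T.IsInner).card = _ at h3
  omega

/-- Two adjacent pendant vertices would be the whole tree. If `w` had degree at most 2, then either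
`p`, `q`, `w` exhaust the tree or `w`, `q`, `p` is a pendant $P_3$. -/
theorem pendantSparse_of_isReducedGraph [DecidableEq V] (hT : T.Connected)
    (hn : 4 ≤ Fintype.card V) (hred : IsReducedGraph T) (hP : ¬ HasPendantPath T 3) :
    T.PendantSparse where
  degree_pos v := by
    have : Nontrivial V := Fintype.one_lt_card_iff_nontrivial.1 (by omega)
    exact hT.preconnected.degree_pos_of_nontrivial v
  degree_ne_one u v huv hu hv := by
    have := hT.card_le_of_forall_adj_mem {u, v} (Finset.mem_insert_self u _) (by
      intro a ha b hab
      simp only [Finset.mem_insert, Finset.mem_singleton] at ha ⊢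
      rcases ha with rfl | rfl
      · exact Or.inr (eq_of_degree_eq_one hu hab huv)
      · exact Or.inl (eq_of_degree_eq_one hv hab huv.symm))
    have := Finset.card_le_two (a := u) (b := v)
    omega
  pendant_unique q u v := pendant_unique_of_isReducedGraph hred
  three_le_degree p q w hpq hp hq hqw hwp := by
    by_contra hlt
    have hN : ∀ c, T.Adj q c → c = p ∨ c = w := fun c =>
      eq_or_eq_of_degree_eq_two hq hpq.symm hqw hwp.symm
    have hNp : ∀ c, T.Adj p c → c = q := fun c hc => eq_of_degree_eq_one hp hc hpq
    by_cases hex : ∃ y, T.Adj w y ∧ y ≠ q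
    · obtain ⟨y, hwy, hyq⟩ := hex
      have hw : T.degree w = 2 := by
        have : ({q, y} : Finset V).card ≤ T.degree w := Finset.card_le_card (by
          simp [Finset.insert_subset_iff, hwy, hqw.symm])
        rw [Finset.card_pair hyq.symm] at this
        omega
      have hNw : ∀ c, T.Adj w c → c = q ∨ c = y := fun c =>
        eq_or_eq_of_degree_eq_two hw hqw.symm hwy hyq.symm
      have hpw : ¬ T.Adj p w := fun hadj => hqw.ne (hNp w hadj).symm
      have hyp : y ≠ p := by
        rintro rfl
        exact hpw hwy.symm
      apply hP
      -- The list starts at `w` because `HasPendantPath` attaches the path at index 0.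
      have hinj : Function.Injective ![w, q, p] := by
        have h1 := hqw.ne
        have h2 := hpq.ne
        intro i j hij
        fin_cases i <;> fin_cases j <;> simp_all
      refine ⟨⟨⟨![w, q, p], hinj⟩, ?_⟩, y, ?_, ?_⟩
      · intro i j
        have h1 := hqw.symm
        have h2 := hpq.symm
        have h3 : ¬ T.Adj w p := fun h => hpw h.symm
        rw [pathGraph_adj]
        fin_cases i <;> fin_cases j <;> simp_all [T.adj_comm]
      · rintro ⟨i, hi⟩
        have h3 := hwy.ne
        fin_cases i <;> simp_all
      · intro i x hx
        have hxw : x ≠ w := fun h => hx ⟨0, by simp [h]⟩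
        have hxq : x ≠ q := fun h => hx ⟨1, by simp [h]⟩
        have hxp : x ≠ p := fun h => hx ⟨2, by simp [h]⟩
        fin_cases i
        · simp only [RelEmbedding.coe_mk]
          constructor
          · intro h
            exact ⟨rfl, (hNw x h).resolve_left hxq⟩
          · rintro ⟨-, rfl⟩
            exact hwy
        · simp only [RelEmbedding.coe_mk]
          constructor
          · intro h
            rcases hN x h with h | h <;> contradiction
          · rintro ⟨h, -⟩
            simp at h
        · simp only [RelEmbedding.coe_mk]
          constructor
          · intro h
            exact absurd (hNp x h) hxq
          · rintro ⟨h, -⟩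
            simp [Fin.ext_iff] at h
    · push Not at hex
      have := hT.card_le_of_forall_adj_mem {p, q, w} (Finset.mem_insert_self p _) (by
        intro a ha b hab
        simp only [Finset.mem_insert, Finset.mem_singleton] at ha ⊢
        rcases ha with rfl | rfl | rfl
        · exact Or.inr (Or.inl (hNp b hab))
        · rcases hN b hab with h | h <;> simp [h]
        · exact Or.inr (Or.inl (hex b hab)))
      have := Finset.card_le_three (a := p) (b := q) (c := w)
      omega

end SimpleGraph

/-! ### Eigenvectors are determined on a hanging transversal -/

namespace SimpleGraph

variable {V : Type*} [Fintype V] (T : SimpleGraph V) [DecidableRel T.Adj] (r : V) (par : V → V)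

/-- An inner vertex all of whose children are quasi-pendant. -/
def IsBottom (v : V) : Prop :=
  T.IsInner v ∧ ∀ u, u ≠ r → par u = v → T.IsQuasiPendant u

/-- A quasi-pendant vertex whose parent is a bottom vertex with an inner parent. -/
def IsHanging (q : V) : Prop :=
  T.IsQuasiPendant q ∧ q ≠ r ∧ T.IsBottom r par (par q) ∧ T.IsInner (par (par q))

/-- `U` contains exactly one hanging vertex below each inner vertex that is the grandparent of
a hanging vertex. -/
structure IsHangingTransversal (U : Finset V) : Prop where
  hanging : ∀ q ∈ U, T.IsHanging r par q
  injOn : ∀ q ∈ U, ∀ q' ∈ U, par (par q) = par (par q') → q = q'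
  exists_mem : ∀ q, T.IsHanging r par q → ∃ q' ∈ U, par (par q') = par (par q)

theorem exists_isHangingTransversal : ∃ U, T.IsHangingTransversal r par U := by
  classical
  obtain ⟨U, hU, hinj, himg⟩ := Finset.exists_subset_injOn_image_eq_of_surjOn
    (f := fun q => par (par q)) (Finset.univ.filter (T.IsHanging r par) : Finset V)
    ((Finset.univ.filter (T.IsHanging r par)).image fun q => par (par q)) (by
      intro y hy
      simpa using hy)
  refine ⟨U, fun q hq => by simpa using hU hq, fun q hq q' hq' => hinj hq hq', fun q hq => ?_⟩
  have : par (par q) ∈ U.image fun q => par (par q) := by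
    rw [himg]
    exact Finset.mem_image_of_mem (fun q => par (par q)) (by simpa using hq)
  simpa using this

variable {T r par} {d : V → ℕ} {U : Finset V}

/-- An eigenvector of the Laplacian for the eigenvalue `1`, written locally. -/
def IsOneHarmonic (T : SimpleGraph V) [DecidableRel T.Adj] (x : V → ℝ) : Prop :=
  ∀ v, ((T.degree v : ℝ) - 1) * x v = ∑ u ∈ T.neighborFinset v, x u

/-- The equation at a pendant neighbour `p` reads $0\cdot x_p = x_q$. -/
theorem IsOneHarmonic.eq_zero_of_isQuasiPendant {x : V → ℝ} (hx : T.IsOneHarmonic x) {q : V}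
    (hq : T.IsQuasiPendant q) : x q = 0 := by
  classical
  obtain ⟨p, hp, hp1⟩ := hq
  have h1 := hx p
  have h2 : T.neighborFinset p = {q} := by
    symm
    apply Finset.eq_of_subset_of_card_le
    · simpa using hp
    · rw [Finset.card_singleton]
      exact hp1.le
  rw [h2, hp1] at h1
  simpa using h1.symm

theorem IsInner.sub_one_pos (hs : T.PendantSparse) {v : V} (hv : T.IsInner v) :
    (0 : ℝ) < (T.degree v : ℝ) - 1 := by
  have h1 := hv.two_le_degree hs
  have h2 : (2 : ℝ) ≤ T.degree v := by exact_mod_cast h1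
  linarith

theorem IsOneHarmonic.eq_zero_of_forall_adj {x : V → ℝ} (hx : T.IsOneHarmonic x)
    (hs : T.PendantSparse) {v : V} (hv : T.IsInner v) (h0 : ∀ u, T.Adj v u → x u = 0) :
    x v = 0 := by
  have h1 := hx v
  rw [Finset.sum_eq_zero fun u hu => h0 u ((T.mem_neighborFinset v u).1 hu)] at h1
  exact (mul_eq_zero.1 h1).resolve_left (hv.sub_one_pos hs).ne'

/-- A vanishing value at `v` propagates to a neighbour when all other neighbours vanish. -/
theorem IsOneHarmonic.eq_sum_of_forall_adj_ne {x : V → ℝ} (hx : T.IsOneHarmonic x) {v w : V}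
    (hvw : T.Adj v w) (h0 : ∀ u, T.Adj v u → u ≠ w → x u = 0) :
    ((T.degree v : ℝ) - 1) * x v = x w := by
  rw [hx v]
  refine Finset.sum_eq_single_of_mem w ((T.mem_neighborFinset v w).2 hvw) fun u hu hne => ?_
  exact h0 u ((T.mem_neighborFinset v u).1 hu) hne

/-- The equation at a quasi-pendant vertex recovers the value at its only pendant neighbour from its
other neighbours. -/
theorem IsOneHarmonic.eq_zero_of_forall_inner {x : V → ℝ} (hx : T.IsOneHarmonic x)
    (hs : T.PendantSparse) (h0 : ∀ v, T.IsInner v → x v = 0) : x = 0 := by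
  have h1 : ∀ v, T.degree v ≠ 1 → x v = 0 := fun v hv =>
    (isInner_or_isQuasiPendant hv).elim (h0 v) fun h => hx.eq_zero_of_isQuasiPendant h
  funext v
  by_cases hv : T.degree v = 1
  · obtain ⟨q, hq⟩ := (degree_eq_one_iff_existsUnique_adj.1 hv).exists
    have hqq : T.IsQuasiPendant q := ⟨v, hq, hv⟩
    have h2 := hx.eq_sum_of_forall_adj_ne hq.symm fun u hu hne =>
      h1 u fun hu1 => hne (hs.pendant_unique q u v hu.symm hq hu1 hv)
    rw [hx.eq_zero_of_isQuasiPendant hqq, mul_zero] at h2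
    exact h2.symm
  · exact h1 v hv

theorem IsInner.ne_root (hr : T.degree r = 1) {v : V} (hv : T.IsInner v) : v ≠ r := by
  rintro rfl
  exact hv.1 hr

namespace IsRooting

variable (h : T.IsRooting r par d)
include h

/-- Every non-root vertex of degree at least two has a child. -/
theorem exists_child_of_two_le_degree {v : V} (hv : 2 ≤ T.degree v) :
    ∃ c, c ≠ r ∧ par c = v := by
  obtain ⟨c, hc, hcv⟩ := exists_adj_notMem_of_card_lt_degree {par v}
    (show ({par v} : Finset V).card < T.degree v by rw [Finset.card_singleton]; omega)
  exact ⟨c, h.child_of_adj hc.symm (Or.inr (by simpa using hcv))⟩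

theorem degree_par_ne_one {v : V} (hvr : v ≠ r) (hpr : par v ≠ r) : T.degree (par v) ≠ 1 := by
  intro h1
  have h2 := h.adj_par hpr
  have h3 := eq_of_degree_eq_one h1 (h.adj_par hvr).symm h2
  have h4 := h.depth_par v hvr
  have h5 := h.depth_par (par v) hpr
  rw [← h3] at h5
  omega

theorem degree_par_ne_one_of_isInner {v : V} (hv : T.IsInner v)
    (hvr : v ≠ r) : T.degree (par v) ≠ 1 :=
  hv.degree_ne_one_of_adj (h.adj_par hvr).symm

/-- Inner values vanish by induction from the deepest level upwards. For a bottom vertex, the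
children are quasi-pendant and an inner parent is a grandparent of `U`, so all neighbours vanish.
Any other inner vertex is controlled by the equation at an inner child. -/
theorem eq_zero_of_vanish_on_transversal (hs : T.PendantSparse) (hr : T.degree r = 1)
    (hU : T.IsHangingTransversal r par U) {x : V → ℝ} (hx : T.IsOneHarmonic x)
    (h0 : ∀ q ∈ U, x (par (par q)) = 0) : x = 0 := by
  apply hx.eq_zero_of_forall_inner hs
  have hM : ∀ v, d v ≤ Finset.univ.sup d := fun v => Finset.le_sup (Finset.mem_univ v)
  -- `n` bounds the number of levels from that of `v` down to the maximal depth, inclusive; at `n =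
  -- 0` no vertex qualifies.
  have key : ∀ n v, Finset.univ.sup d + 1 ≤ d v + n → T.IsInner v → x v = 0 := by
    intro n
    induction n with
    | zero =>
      intro v hv _
      have := hM v
      omega
    | succ n ih =>
      intro v hv hin
      have hvr := hin.ne_root hr
      have hchild : ∀ c, c ≠ r → par c = v → x c = 0 := by
        intro c hc hcv
        have h1 : T.degree c ≠ 1 := hin.degree_ne_one_of_adj (hcv ▸ h.adj_par hc)
        rcases isInner_or_isQuasiPendant h1 with h2 | h2
        · have := h.depth_par c hc
          rw [hcv] at this
          exact ih c (by omega) h2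
        · exact hx.eq_zero_of_isQuasiPendant h2
      by_cases hb : T.IsBottom r par v
      · apply hx.eq_zero_of_forall_adj hs hin
        intro u hu
        by_cases hup : u = par v
        · rw [hup]
          rcases isInner_or_isQuasiPendant (h.degree_par_ne_one_of_isInner hin hvr) with h2 | h2
          · obtain ⟨c, hc, hcv⟩ := h.exists_child_of_two_le_degree (hin.two_le_degree hs)
            obtain ⟨q, hq, hqc⟩ := hU.exists_mem c
              ⟨hb.2 c hc hcv, hc, by rwa [hcv], by rwa [hcv]⟩
            rw [← hcv, ← hqc]
            exact h0 q hq
          · exact hx.eq_zero_of_isQuasiPendant h2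
        · obtain ⟨h1, h2⟩ := h.child_of_adj hu.symm (Or.inr hup)
          exact hchild u h1 h2
      · have : ∃ c, c ≠ r ∧ par c = v ∧ ¬ T.IsQuasiPendant c := by
          by_contra hcon
          push Not at hcon
          exact hb ⟨hin, hcon⟩
        obtain ⟨c, hc, hcv, hcq⟩ := this
        have hcadj : T.Adj c v := hcv ▸ h.adj_par hc
        have hcin : T.IsInner c := ⟨hin.degree_ne_one_of_adj hcadj, hcq⟩
        have hdc := h.depth_par c hc
        rw [hcv] at hdc
        -- In the equation at `c`, both `x c` and the values at the children of `c` vanish by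
        -- induction, leaving only `x v`.
        have h1 := hx.eq_sum_of_forall_adj_ne hcadj fun u hu hne => by
          obtain ⟨hu1, hu2⟩ := h.child_of_adj hu.symm (Or.inr (by rwa [hcv]))
          have h3 : T.degree u ≠ 1 := hcin.degree_ne_one_of_adj hu.symm
          rcases isInner_or_isQuasiPendant h3 with h2 | h2
          · have := h.depth_par u hu1
            rw [hu2] at this
            exact ih u (by omega) h2
          · exact hx.eq_zero_of_isQuasiPendant h2
        rw [hchild c hc hcv, mul_zero] at h1
        exact h1.symm
  exact fun v hv => key (Finset.univ.sup d + 1) v (by omega) hv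

/-- Evaluation of an eigenvector at the grandparents of a hanging transversal. -/
theorem injective_eval_transversal [DecidableEq V] (hs : T.PendantSparse) (hr : T.degree r = 1)
    (hU : T.IsHangingTransversal r par U) :
    Function.Injective ((LinearMap.funLeft ℝ ℝ fun q : U => par (par q.1)).comp
      (Module.End.eigenspace (Matrix.toLin' (T.lapMatrix ℝ)) 1).subtype) := by
  rw [injective_iff_map_eq_zero]
  rintro ⟨x, hx⟩ h0
  have := h.eq_zero_of_vanish_on_transversal hs hr hU (mem_eigenspace_lapMatrix_one.1 hx)
    fun q hq => congrFun h0 ⟨q, hq⟩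
  simpa using this

theorem laplacianMultiplicity_le_card [DecidableEq V] (hs : T.PendantSparse)
    (hr : T.degree r = 1) (hU : T.IsHangingTransversal r par U) :
    laplacianMultiplicity T 1 ≤ U.card := by
  rw [laplacianMultiplicity_eq_finrank]
  simpa using LinearMap.finrank_le_finrank_of_injective (h.injective_eval_transversal hs hr hU)

/-- When the multiplicity attains the size of the transversal, eigenvectors take arbitrary
values on it. -/
theorem exists_isOneHarmonic_eval [DecidableEq V] (hs : T.PendantSparse) (hr : T.degree r = 1)
    (hU : T.IsHangingTransversal r par U) (hm : laplacianMultiplicity T 1 = U.card) (y : U → ℝ) :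
    ∃ x, T.IsOneHarmonic x ∧ ∀ q : U, x (par (par q.1)) = y q := by
  rw [laplacianMultiplicity_eq_finrank] at hm
  have hsurj := (LinearMap.injective_iff_surjective_of_finrank_eq_finrank (by simpa using hm)).1
    (h.injective_eval_transversal hs hr hU)
  obtain ⟨⟨x, hx⟩, hxy⟩ := hsurj y
  exact ⟨x, mem_eigenspace_lapMatrix_one.1 hx, fun q => congrFun hxy q⟩

end IsRooting

end SimpleGraph

/-! ### Counting quasi-pendant and inner vertices -/

namespace SimpleGraph

variable {V : Type*} [Fintype V] {T : SimpleGraph V} [DecidableRel T.Adj] {r : V} {par : V → V}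
  {d : V → ℕ} {U : Finset V}

/-- `v` is a descendant of `a`. -/
def IsDescendant (par : V → V) (d : V → ℕ) (a v : V) : Prop := ∃ k ≤ d v, par^[k] v = a

omit [Fintype V] in
theorem IsDescendant.refl (a : V) : IsDescendant par d a a := ⟨0, Nat.zero_le _, rfl⟩

namespace IsRooting

section Descendant

omit [Fintype V] [DecidableRel T.Adj]
variable (h : T.IsRooting r par d)
include h

theorem isDescendant_of_par {a v : V} (hv : v ≠ r) (ha : IsDescendant par d a (par v)) :
    IsDescendant par d a v := by
  obtain ⟨k, hk, hka⟩ := ha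
  have := h.depth_par v hv
  exact ⟨k + 1, by omega, hka⟩

theorem isDescendant_par {a v : V} (ha : IsDescendant par d a v) (hne : v ≠ a) :
    v ≠ r ∧ IsDescendant par d a (par v) := by
  obtain ⟨k, hk, hka⟩ := ha
  cases k with
  | zero => exact absurd hka hne
  | succ k =>
    have hv : v ≠ r := h.ne_root_of_depth_pos (by omega)
    have := h.depth_par v hv
    exact ⟨hv, k, by omega, hka⟩

theorem depth_le_of_isDescendant {a v : V} (ha : IsDescendant par d a v) : d a ≤ d v := by
  obtain ⟨k, hk, rfl⟩ := ha
  have := h.depth_iterate hk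
  omega

theorem eq_of_isDescendant {a b v : V} (ha : IsDescendant par d a v)
    (hb : IsDescendant par d b v) (hab : d a = d b) : a = b := by
  obtain ⟨k, hk, rfl⟩ := ha
  obtain ⟨l, hl, rfl⟩ := hb
  have h1 := h.depth_iterate hk
  have h2 := h.depth_iterate hl
  have : k = l := by omega
  rw [this]

end Descendant

variable (h : T.IsRooting r par d)
include h

/-- If all children of `par z` are pendant, then `par z` has degree two and its parent has degree
at least three. -/
theorem degree_of_pendant_children (hs : T.PendantSparse) {z : V} (hz : z ≠ r) (hpz : par z ≠ r)
    (hc : ∀ c, c ≠ r → par c = par z → T.degree c = 1) :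
    T.degree (par z) = 2 ∧ 3 ≤ T.degree (par (par z)) := by
  classical
  have hz1 := hc z hz rfl
  have hzq := h.adj_par hz
  have hqw := h.adj_par hpz
  have h2 : T.degree (par z) = 2 := by
    apply le_antisymm
    · refine (degree_le_of_forall_adj_mem {z, par (par z)} fun u hu => ?_).trans
        Finset.card_le_two
      by_cases hup : u = par (par z)
      · simp [hup]
      · obtain ⟨h1, h2⟩ := h.child_of_adj hu.symm (Or.inr hup)
        have := hs.pendant_unique _ u z hu.symm hzq (hc u h1 h2) hz1
        simp [this]
    · exact IsQuasiPendant.two_le_degree hs ⟨z, hzq, hz1⟩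
  refine ⟨h2, hs.three_le_degree z (par z) _ hzq hz1 h2 hqw ?_⟩
  intro heq
  have h3 := h.depth_par z hz
  have h4 := h.depth_par _ hpz
  rw [heq] at h4
  omega

theorem degree_eq_one_of_forall_ne (hs : T.PendantSparse) {z : V}
    (hz : ∀ c, c ≠ r → par c ≠ z) : T.degree z = 1 := by
  by_contra h1
  have := hs.degree_pos z
  obtain ⟨c, hc, hcz⟩ := h.exists_child_of_two_le_degree (v := z) (by omega)
  exact hz c hc hcz

/-- Below every non-root vertex with a grandchild there is a quasi-pendant vertex outside the
transversal. -/
theorem exists_isDescendant_notMem (hs : T.PendantSparse) (hU : T.IsHangingTransversal r par U)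
    {a z₀ : V} (ha : a ≠ r) (hz₀ : z₀ ≠ r) (hpz₀ : par z₀ ≠ r) (hz₀a : par (par z₀) = a) :
    ∃ q, T.IsQuasiPendant q ∧ q ∉ U ∧ IsDescendant par d a q ∧ q ≠ a := by
  classical
  have hdz₀ := h.depth_par z₀ hz₀
  have hdpz₀ := h.depth_par _ hpz₀
  have hz₀desc : IsDescendant par d a z₀ :=
    h.isDescendant_of_par hz₀ (h.isDescendant_of_par hpz₀ (hz₀a ▸ IsDescendant.refl _))
  -- A deepest descendant `z` of `a` has only pendant siblings, so `par z` has degree 2 and its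
  -- parent has degree at least 3. The grandchild `z₀` ensures that `z` lies at least two levels
  -- below `a`.
  obtain ⟨z, hz, hmax⟩ := Finset.exists_max_image (Finset.univ.filter (IsDescendant par d a)) d
    ⟨z₀, by simpa using hz₀desc⟩
  simp only [Finset.mem_filter, Finset.mem_univ, true_and] at hz hmax
  have hda := h.depth_pos ha
  have hle := hmax z₀ hz₀desc
  rw [hz₀a] at hdpz₀
  obtain ⟨hzr, hq⟩ := h.isDescendant_par hz (by rintro rfl; omega)
  have hdz := h.depth_par z hzr
  obtain ⟨hqr, hw⟩ := h.isDescendant_par hq (by intro heq; rw [heq] at hdz; omega)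
  have hdq := h.depth_par _ hqr
  have hdw := h.depth_le_of_isDescendant hw
  have hpend : ∀ c, c ≠ r → par c = par z → T.degree c = 1 := by
    intro c hc hcz
    apply h.degree_eq_one_of_forall_ne hs
    intro e he hec
    have hcd : IsDescendant par d a e := by
      apply h.isDescendant_of_par he
      rw [hec]
      apply h.isDescendant_of_par hc
      rwa [hcz]
    have h1 := hmax e hcd
    have h2 := h.depth_par e he
    have h3 := h.depth_par c hc
    rw [hcz] at h3
    rw [hec] at h2
    omega
  obtain ⟨-, hw3⟩ := h.degree_of_pendant_children hs hzr hqr hpend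
  have hqq : T.IsQuasiPendant (par z) := ⟨z, h.adj_par hzr, hpend z hzr rfl⟩
  by_cases hqU : par z ∈ U
  -- If `par z` is in `U`, its parent is bottom and has a second, quasi-pendant child; that child
  -- has the same grandparent, so the transversal omits it.
  · have hh := hU.hanging _ hqU
    obtain ⟨q', hq', hq'n⟩ := exists_adj_notMem_of_card_lt_degree {par (par (par z)), par z}
      (lt_of_le_of_lt Finset.card_le_two (show 2 < T.degree (par (par z)) from hw3))
    simp only [Finset.mem_insert, Finset.mem_singleton, not_or] at hq'n
    obtain ⟨hq'r, hq'w⟩ := h.child_of_adj hq'.symm (Or.inr hq'n.1)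
    refine ⟨q', hh.2.2.1.2 q' hq'r hq'w, fun hq'U => ?_, ?_, ?_⟩
    · exact hq'n.2 (hU.injOn q' hq'U _ hqU (by rw [hq'w]))
    · apply h.isDescendant_of_par hq'r
      rwa [hq'w]
    · rintro rfl
      have := h.depth_par _ hq'r
      rw [hq'w] at this
      omega
  · refine ⟨par z, hqq, hqU, hq, ?_⟩
    intro heq
    rw [heq] at hdz
    omega

/-- The parent of a deepest vertex works. Depth at least 2 is guaranteed, since otherwise `r` would
have two pendant neighbours. -/
theorem exists_pendant_adj_degree_eq_two (hs : T.PendantSparse) (hn : 3 ≤ Fintype.card V) :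
    ∃ p q, T.Adj p q ∧ T.degree p = 1 ∧ T.degree q = 2 := by
  classical
  obtain ⟨z, -, hmax⟩ := Finset.exists_max_image Finset.univ d ⟨r, Finset.mem_univ r⟩
  have hmax : ∀ v, d v ≤ d z := fun v => hmax v (Finset.mem_univ v)
  have hpend : ∀ c, d c = d z → T.degree c = 1 := by
    intro c hc
    apply h.degree_eq_one_of_forall_ne hs
    intro e he hec
    have h1 := hmax e
    have h2 := h.depth_par e he
    rw [hec] at h2
    omega
  have hz2 : 2 ≤ d z := by
    by_contra hlt
    have h1 : ∀ v, v ≠ r → par v = r ∧ T.degree v = 1 := by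
      intro v hv
      have h2 := h.depth_par v hv
      have h3 := hmax v
      exact ⟨h.eq_root_of_depth_eq_zero (by omega), hpend v (by omega)⟩
    obtain ⟨u, hu⟩ := Finset.exists_mem_notMem_of_card_lt_card
      (s := {r}) (t := Finset.univ) (by simpa [Finset.card_univ] using by omega)
    obtain ⟨v, hv⟩ := Finset.exists_mem_notMem_of_card_lt_card
      (s := {r, u}) (t := Finset.univ) (by
        have := Finset.card_le_two (a := r) (b := u)
        rw [Finset.card_univ]
        omega)
    simp only [Finset.mem_univ, Finset.mem_insert, Finset.mem_singleton, not_or, true_and]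
      at hu hv
    have hur := h1 u hu
    have hvr := h1 v hv.1
    have hua := h.adj_par hu
    have hva := h.adj_par hv.1
    rw [hur.1] at hua
    rw [hvr.1] at hva
    exact hv.2 (hs.pendant_unique r v u hva hua hvr.2 hur.2)
  have hzr : z ≠ r := h.ne_root_of_depth_pos (by omega)
  have hdz := h.depth_par z hzr
  have hqr : par z ≠ r := h.ne_root_of_depth_pos (by omega)
  refine ⟨z, par z, h.adj_par hzr, hpend z rfl, (h.degree_of_pendant_children hs hzr hqr ?_).1⟩
  intro c hc hcz
  have := h.depth_par c hc
  rw [hcz] at this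
  exact hpend c (by omega)

end IsRooting

/-- The root `r` is pendant, its neighbour `q` has degree two, and `w` is the child of `q`. -/
structure IsPendantRoot (T : SimpleGraph V) [DecidableRel T.Adj] (r : V) (par : V → V)
    (d : V → ℕ) (q w : V) : Prop extends T.IsRooting r par d where
  degree_root : T.degree r = 1
  child_ne : q ≠ r
  par_child : par q = r
  grandchild_ne : w ≠ r
  par_grandchild : par w = q
  three_le_degree : 3 ≤ T.degree w

theorem exists_isPendantRoot (hT : T.IsTree) (hs : T.PendantSparse) (hn : 3 ≤ Fintype.card V) :
    ∃ r par d q w, T.IsPendantRoot r par d q w := by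
  obtain ⟨a⟩ := hT.connected.nonempty
  obtain ⟨par', d', h'⟩ := hT.exists_isRooting a
  obtain ⟨r, q, hrq, hr, hq⟩ := h'.exists_pendant_adj_degree_eq_two hs hn
  obtain ⟨par, d, h⟩ := hT.exists_isRooting r
  obtain ⟨hqr, hpq⟩ := h.child_of_adj hrq.symm (Or.inl rfl)
  obtain ⟨w, hwr, hpw⟩ := h.exists_child_of_two_le_degree hq.ge
  refine ⟨r, par, d, q, w, h, hr, hqr, hpq, hwr, hpw, ?_⟩
  have hwq := h.adj_par hwr
  rw [hpw] at hwq
  exact hs.three_le_degree r q w hrq hr hq hwq.symm hwr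

namespace IsPendantRoot

variable {q w : V} (h : T.IsPendantRoot r par d q w)
include h

theorem isQuasiPendant_child : T.IsQuasiPendant q := by
  have := h.adj_par h.child_ne
  rw [h.par_child] at this
  exact ⟨r, this.symm, h.degree_root⟩

theorem depth_child : d q = 1 := by
  have := h.depth_par q h.child_ne
  rw [h.par_child, h.depth_root] at this
  exact this.symm

theorem depth_grandchild : d w = 2 := by
  have := h.depth_par w h.grandchild_ne
  rw [h.par_grandchild, h.depth_child] at this
  exact this.symm

theorem child_notMem (hU : T.IsHangingTransversal r par U) : q ∉ U := by
  intro hq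
  have := (hU.hanging q hq).2.2.1.1
  rw [h.par_child] at this
  exact this.1 h.degree_root

theorem grandchild_notMem (hU : T.IsHangingTransversal r par U) : w ∉ U := by
  intro hw
  have := (hU.hanging w hw).2.2.1.1
  rw [h.par_grandchild] at this
  exact this.2 h.isQuasiPendant_child

/-- Below an inner child `a` of `w`, or at a quasi-pendant one, the transversal misses a
quasi-pendant vertex. -/
theorem exists_notMem_below_child (hs : T.PendantSparse) (hU : T.IsHangingTransversal r par U)
    {a : V} (har : a ≠ r) (haw : par a = w) (ha1 : T.degree a ≠ 1) :
    ∃ c, T.IsQuasiPendant c ∧ c ∉ U ∧ IsDescendant par d a c := by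
  rcases isInner_or_isQuasiPendant ha1 with hin | hq
  · obtain ⟨b, hbr, hb⟩ := h.exists_child_of_two_le_degree (hin.two_le_degree hs)
    have hb1 : T.degree b ≠ 1 := hin.degree_ne_one_of_adj (hb ▸ h.adj_par hbr)
    have hbpos := hs.degree_pos b
    obtain ⟨c, hcr, hc⟩ := h.exists_child_of_two_le_degree (v := b) (by omega)
    obtain ⟨e, h1, h2, h3, -⟩ := h.exists_isDescendant_notMem hs hU har hcr (by rwa [hc])
      (by rw [hc, hb])
    exact ⟨e, h1, h2, h3⟩
  · refine ⟨a, hq, fun haU => ?_, IsDescendant.refl a⟩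
    have := (hU.hanging a haU).2.2.2
    rw [haw, h.par_grandchild] at this
    exact this.2 h.isQuasiPendant_child

/-- If `w` is quasi-pendant, take `w` itself and a missed vertex strictly below it. If `w` is inner,
its degree gives two children besides `q`, and each of their disjoint branches contains a missed
vertex. -/
theorem exists_two_notMem (hs : T.PendantSparse) (hU : T.IsHangingTransversal r par U) :
    ∃ a b, T.IsQuasiPendant a ∧ T.IsQuasiPendant b ∧ a ∉ U ∧ b ∉ U ∧ a ≠ b ∧ a ≠ q ∧ b ≠ q := by
  classical
  have hdq := h.depth_child
  have hdw := h.depth_grandchild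
  have hchild : ∀ c, T.Adj w c → c ≠ q → c ≠ r ∧ par c = w := fun c hc hcq =>
    h.child_of_adj hc.symm (Or.inr (by rwa [h.par_grandchild]))
  by_cases hwq : T.IsQuasiPendant w
  · obtain ⟨y, hyw, hy1⟩ := hwq
    obtain ⟨c, hc, hcn⟩ := exists_adj_notMem_of_card_lt_degree {q, y}
      (lt_of_le_of_lt Finset.card_le_two (show 2 < T.degree w from h.three_le_degree))
    simp only [Finset.mem_insert, Finset.mem_singleton, not_or] at hcn
    obtain ⟨hcr, hcw⟩ := hchild c hc hcn.1
    have hc1 : T.degree c ≠ 1 := fun hc1 =>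
      hcn.2 (hs.pendant_unique w c y hc.symm hyw hc1 hy1)
    have hcpos := hs.degree_pos c
    obtain ⟨e, her, he⟩ := h.exists_child_of_two_le_degree (v := c) (by omega)
    obtain ⟨b, hb1, hb2, hb3, hb4⟩ := h.exists_isDescendant_notMem hs hU h.grandchild_ne her
      (by rwa [he]) (by rw [he, hcw])
    refine ⟨w, b, ⟨y, hyw, hy1⟩, hb1, h.grandchild_notMem hU, hb2, hb4.symm, ?_, ?_⟩
    · rintro rfl
      omega
    · rintro rfl
      have := h.depth_le_of_isDescendant hb3
      omega
  · have hin : T.IsInner w := ⟨by have := h.three_le_degree; omega, hwq⟩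
    have hw3 := h.three_le_degree
    obtain ⟨a, ha, han⟩ := exists_adj_notMem_of_card_lt_degree {q}
      (show ({q} : Finset V).card < T.degree w by rw [Finset.card_singleton]; omega)
    obtain ⟨b, hb, hbn⟩ := exists_adj_notMem_of_card_lt_degree {q, a}
      (lt_of_le_of_lt Finset.card_le_two (show 2 < T.degree w from h.three_le_degree))
    simp only [Finset.mem_insert, Finset.mem_singleton, not_or] at han hbn
    obtain ⟨har, haw⟩ := hchild a ha han
    obtain ⟨hbr, hbw⟩ := hchild b hb hbn.1
    have hda := h.depth_par a har
    have hdb := h.depth_par b hbr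
    rw [haw] at hda
    rw [hbw] at hdb
    obtain ⟨a', ha1, ha2, ha3⟩ := h.exists_notMem_below_child hs hU har haw
      (hin.degree_ne_one_of_adj ha.symm)
    obtain ⟨b', hb1, hb2, hb3⟩ := h.exists_notMem_below_child hs hU hbr hbw
      (hin.degree_ne_one_of_adj hb.symm)
    have h1 := h.depth_le_of_isDescendant ha3
    have h2 := h.depth_le_of_isDescendant hb3
    refine ⟨a', b', ha1, hb1, ha2, hb2, ?_, ?_, ?_⟩
    · rintro rfl
      exact hbn.2 (h.eq_of_isDescendant ha3 hb3 (by omega)).symm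
    · rintro rfl
      omega
    · rintro rfl
      omega

theorem card_add_three_le (hs : T.PendantSparse) (hU : T.IsHangingTransversal r par U) :
    U.card + 3 ≤ (Finset.univ.filter T.IsQuasiPendant).card := by
  classical
  obtain ⟨a, b, ha, hb, haU, hbU, hab, haq, hbq⟩ := h.exists_two_notMem hs hU
  have h3 : ({q, a, b} : Finset V).card = 3 :=
    Finset.card_eq_three.2 ⟨q, a, b, haq.symm, hbq.symm, hab, rfl⟩
  have hdisj : Disjoint U {q, a, b} := by
    rw [Finset.disjoint_right]
    simp [haU, hbU, h.child_notMem hU]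
  rw [← h3, ← Finset.card_union_of_disjoint hdisj]
  refine Finset.card_le_card fun v hv => ?_
  simp only [Finset.mem_union, Finset.mem_insert, Finset.mem_singleton] at hv
  simp only [Finset.mem_filter, Finset.mem_univ, true_and]
  rcases hv with hv | rfl | rfl | rfl
  · exact (hU.hanging v hv).1
  · exact h.isQuasiPendant_child
  · exact ha
  · exact hb

end IsPendantRoot

theorem IsInner.not_isBottom_par (hr : T.degree r = 1) {v : V} (hv : T.IsInner v) :
    ¬ T.IsBottom r par (par v) :=
  fun hb => hv.2 (hb.2 v (hv.ne_root hr) rfl)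

theorem IsHangingTransversal.image_union_image_subset [DecidableEq V]
    (hU : T.IsHangingTransversal r par U) :
    (U.image par ∪ U.image fun q => par (par q)) ⊆ Finset.univ.filter T.IsInner := by
  intro v hv
  simp only [Finset.mem_filter, Finset.mem_univ, true_and]
  rcases Finset.mem_union.1 hv with hv | hv
  · obtain ⟨a, ha, rfl⟩ := Finset.mem_image.1 hv
    exact (hU.hanging a ha).2.2.1.1
  · obtain ⟨a, ha, rfl⟩ := Finset.mem_image.1 hv
    exact (hU.hanging a ha).2.2.2

/-- Parents of `U` are bottom, whereas grandparents have an inner child and so are not; hence the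
two images are disjoint. -/
theorem IsHangingTransversal.card_image_union_image [DecidableEq V]
    (hU : T.IsHangingTransversal r par U) (hr : T.degree r = 1) :
    (U.image par ∪ U.image fun q => par (par q)).card = 2 * U.card := by
  rw [Finset.card_union_of_disjoint, Finset.card_image_of_injOn, Finset.card_image_of_injOn,
    two_mul]
  · exact fun a ha b hb => hU.injOn a ha b hb
  · exact fun a ha b hb hab => hU.injOn a ha b hb (congrArg par hab)
  · rw [Finset.disjoint_left]
    intro v hv hv'
    obtain ⟨a, ha, rfl⟩ := Finset.mem_image.1 hv
    obtain ⟨b, hb, hba⟩ := Finset.mem_image.1 hv'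
    refine IsInner.not_isBottom_par (par := par) hr (hU.hanging b hb).2.2.1.1 ?_
    rw [hba]
    exact (hU.hanging a ha).2.2.1

theorem IsHangingTransversal.two_mul_card_le (hU : T.IsHangingTransversal r par U)
    (hr : T.degree r = 1) :
    2 * U.card ≤ (Finset.univ.filter T.IsInner).card := by
  classical
  rw [← hU.card_image_union_image hr]
  exact Finset.card_le_card (hU.image_union_image_subset)

theorem four_mul_laplacianMultiplicity_add_six_le [DecidableEq V] (hT : T.IsTree)
    (hn : 4 ≤ Fintype.card V) (hred : IsReducedGraph T) (hP : ¬ HasPendantPath T 3) :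
    4 * laplacianMultiplicity T 1 + 6 ≤ Fintype.card V := by
  have hs := pendantSparse_of_isReducedGraph hT.connected hn hred hP
  obtain ⟨r, par, d, q, w, h⟩ := exists_isPendantRoot hT hs (by omega)
  obtain ⟨U, hU⟩ := T.exists_isHangingTransversal r par
  have h1 := h.laplacianMultiplicity_le_card hs h.degree_root hU
  have h2 := h.card_add_three_le hs hU
  have h3 := hU.two_mul_card_le h.degree_root
  have h4 := card_eq_of_isReducedGraph hs hred
  omega

end SimpleGraph

/-! ### The equality case: a tight tree is extremal -/

namespace SimpleGraph

/-- The parent function of the extremal tree rooted at the end `0` of its spine. -/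
def extremalPar (k : ℕ) : Fin (3 * k + 2) ⊕ Fin k → Fin (3 * k + 2) ⊕ Fin k
  | .inl a => .inl ⟨a.val - 1, by omega⟩
  | .inr i => .inl ⟨3 * i.val + 2, by omega⟩

theorem extremalTree_adj_iff (k : ℕ) (a b : Fin (3 * k + 2) ⊕ Fin k) :
    (extremalTree k).Adj a b ↔
      (a ≠ .inl 0 ∧ extremalPar k a = b) ∨ (b ≠ .inl 0 ∧ extremalPar k b = a) := by
  rcases a with a | i <;> rcases b with b | j
  · change (pathGraph (3 * k + 2)).Adj a b ↔ _
    rw [pathGraph_adj]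
    simp only [extremalPar, ne_eq, Sum.inl.injEq, Fin.ext_iff, Fin.val_zero]
    omega
  · change a.val = 3 * j.val + 2 ↔ _
    simp only [extremalPar, ne_eq, Sum.inl.injEq, Fin.ext_iff, reduceCtorEq, and_false, false_or,
      not_false_eq_true, true_and, eq_comm]
  · change b.val = 3 * i.val + 2 ↔ _
    simp only [extremalPar, ne_eq, Sum.inl.injEq, Fin.ext_iff, reduceCtorEq, and_false, or_false,
      not_false_eq_true, true_and, eq_comm]
  · change False ↔ _
    simp [extremalPar]

variable {V : Type*} {T : SimpleGraph V} {r : V} {par : V → V} {d : V → ℕ}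

theorem IsRooting.nonempty_iso_extremalTree (h : T.IsRooting r par d) {k : ℕ}
    (f : Fin (3 * k + 2) ⊕ Fin k → V) (hf : Function.Bijective f) (hroot : f (.inl 0) = r)
    (hpar : ∀ a, a ≠ .inl 0 → par (f a) = f (extremalPar k a)) :
    Nonempty (T ≃g extremalTree k) := by
  refine ⟨(⟨Equiv.ofBijective f hf, fun {a b} => ?_⟩ : extremalTree k ≃g T).symm⟩
  have hne : ∀ a, f a ≠ r ↔ a ≠ .inl 0 := fun a => by
    rw [← hroot]
    exact hf.1.ne_iff
  have key : ∀ a b, (f a ≠ r ∧ par (f a) = f b) ↔ (a ≠ .inl 0 ∧ extremalPar k a = b) := by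
    intro a b
    rw [hne]
    refine and_congr_right fun ha => ?_
    rw [hpar a ha, hf.1.eq_iff]
  simp only [Equiv.ofBijective_apply]
  rw [h.adj_iff, extremalTree_adj_iff, key, key]

variable [Fintype V] [DecidableRel T.Adj] {q w : V} {U : Finset V}

/-- The configuration forced by equality in the multiplicity bound. -/
structure IsTight (T : SimpleGraph V) [DecidableRel T.Adj] [DecidableEq V] (r : V) (par : V → V)
    (d : V → ℕ) (q w : V) (U : Finset V) : Prop extends
    T.IsPendantRoot r par d q w, T.IsHangingTransversal r par U where
  sparse : T.PendantSparse
  mult : laplacianMultiplicity T 1 = U.card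
  card_inner : (Finset.univ.filter T.IsInner).card = 2 * U.card
  card_quasi : (Finset.univ.filter T.IsQuasiPendant).card = U.card + 3

theorem PendantSparse.exists_child_degree_ne_one (hs : T.PendantSparse)
    (h : T.IsRooting r par d) {v : V} (hv : T.IsQuasiPendant v) (h3 : 3 ≤ T.degree v) :
    ∃ c, c ≠ r ∧ par c = v ∧ T.degree c ≠ 1 := by
  classical
  obtain ⟨p, hp, hp1⟩ := hv
  obtain ⟨c, hc, hcn⟩ := exists_adj_notMem_of_card_lt_degree {par v, p}
    (lt_of_le_of_lt Finset.card_le_two (show 2 < T.degree v from h3))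
  simp only [Finset.mem_insert, Finset.mem_singleton, not_or] at hcn
  obtain ⟨hcr, hcv⟩ := h.child_of_adj hc.symm (Or.inr hcn.1)
  exact ⟨c, hcr, hcv, fun hc1 => hcn.2 (hs.pendant_unique v c p hc.symm hp hc1 hp1)⟩

namespace IsTight

variable [DecidableEq V] (h : T.IsTight r par d q w U)
include h

theorem isInner_cases {v : V} (hv : T.IsInner v) :
    (∃ a ∈ U, par a = v) ∨ ∃ a ∈ U, par (par a) = v := by
  have heq := Finset.eq_of_subset_of_card_le h.toIsHangingTransversal.image_union_image_subset (by
    rw [h.card_inner, h.card_image_union_image h.degree_root])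
  have hmem : v ∈ Finset.univ.filter T.IsInner := by simpa using hv
  rw [← heq] at hmem
  simpa using hmem

/-- Take the eigenvector equal to 1 at the grandparent of `a` and 0 at all the others. The equations
at `par a` and `par (par a)` involve only these two vertices, so the product of their degrees minus
one is 1. -/
theorem degree_par {a : V} (ha : a ∈ U) :
    T.degree (par a) = 2 ∧ T.degree (par (par a)) = 2 := by
  obtain ⟨x, hx, hxU⟩ := h.exists_isOneHarmonic_eval h.sparse h.degree_root
    h.toIsHangingTransversal h.mult (Pi.single ⟨a, ha⟩ 1)
  have hxa : x (par (par a)) = 1 := by simpa using hxU ⟨a, ha⟩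
  have hx0 : ∀ b ∈ U, b ≠ a → x (par (par b)) = 0 := by
    intro b hb hne
    rw [hxU ⟨b, hb⟩, Pi.single_eq_of_ne]
    simpa using hne
  have hbot : ∀ b ∈ U, ((T.degree (par b) : ℝ) - 1) * x (par b) = x (par (par b)) := by
    intro b hb
    have hb' := (h.hanging b hb).2.2.1
    refine hx.eq_sum_of_forall_adj_ne (h.adj_par (hb'.1.ne_root h.degree_root)) ?_
    intro u hu hne
    obtain ⟨h1, h2⟩ := h.child_of_adj hu.symm (Or.inr hne)
    exact hx.eq_zero_of_isQuasiPendant (hb'.2 u h1 h2)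
  have hin := (h.hanging a ha).2.2.1.1
  have hin' := (h.hanging a ha).2.2.2
  have hadj := h.adj_par (hin.ne_root h.degree_root)
  have htop : ((T.degree (par (par a)) : ℝ) - 1) * x (par (par a)) = x (par a) := by
    refine hx.eq_sum_of_forall_adj_ne hadj.symm ?_
    intro u hu hne
    rcases isInner_or_isQuasiPendant (hin'.degree_ne_one_of_adj hu.symm) with hui | huq
    · rcases h.isInner_cases hui with ⟨b, hb, rfl⟩ | ⟨b, hb, rfl⟩
      · have hba : b ≠ a := by
          rintro rfl
          exact hne rfl
        have h1 := hbot b hb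
        rw [hx0 b hb hba] at h1
        exact (mul_eq_zero.1 h1).resolve_left (hui.sub_one_pos h.sparse).ne'
      · refine hx0 b hb ?_
        rintro rfl
        exact hu.ne rfl
    · exact hx.eq_zero_of_isQuasiPendant huq
  have h1 := hbot a ha
  rw [← htop, hxa, mul_one] at h1
  have h2 := hin.two_le_degree h.sparse
  have h3 := hin'.two_le_degree h.sparse
  -- With degrees $2+m$ and $2+n$, the relation $(1+m)(1+n)=1$ leaves $m=n=0$.
  obtain ⟨m, hm⟩ := Nat.exists_eq_add_of_le h2
  obtain ⟨n, hn⟩ := Nat.exists_eq_add_of_le h3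
  rw [hm, hn] at h1 ⊢
  push_cast at h1
  have h4 : (m : ℝ) + n + m * n = 0 := by linarith
  have h5 : m + n + m * n = 0 := by exact_mod_cast h4
  have h6 : m + n = 0 := Nat.eq_zero_of_add_eq_zero_right h5
  omega

theorem degree_of_isInner {v : V} (hv : T.IsInner v) : T.degree v = 2 := by
  rcases h.isInner_cases hv with ⟨a, ha, rfl⟩ | ⟨a, ha, rfl⟩
  · exact (h.degree_par ha).1
  · exact (h.degree_par ha).2

theorem isQuasiPendant_of_three_le {v : V} (hv : 3 ≤ T.degree v) : T.IsQuasiPendant v := by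
  rcases isInner_or_isQuasiPendant (show T.degree v ≠ 1 by omega) with h1 | h1
  · have := h.degree_of_isInner h1
    omega
  · exact h1

theorem card_nonpendant :
    (Finset.univ.filter fun v => T.degree v ≠ 1).card = 3 * U.card + 3 := by
  have h1 : (Finset.univ.filter fun v => T.degree v ≠ 1) =
      Finset.univ.filter T.IsInner ∪ Finset.univ.filter T.IsQuasiPendant := by
    ext v
    simp only [Finset.mem_filter, Finset.mem_univ, true_and, Finset.mem_union]
    exact ⟨isInner_or_isQuasiPendant, fun hv => hv.elim (fun hv => hv.1)
      fun hv => hv.degree_ne_one h.sparse⟩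
  rw [h1, Finset.card_union_of_disjoint, h.card_inner, h.card_quasi]
  · omega
  · rw [Finset.disjoint_filter]
    exact fun v _ hv => hv.2

section Deepest

variable {z : V} (hz : ∀ v, d v ≤ d z)
include hz

theorem two_le_depth : 2 ≤ d z := h.depth_grandchild ▸ hz w

theorem deepest_ne_root : z ≠ r :=
  h.ne_root_of_depth_pos (by have := h.two_le_depth hz; omega)

theorem par_deepest_ne_root : par z ≠ r := by
  have h1 := h.two_le_depth hz
  have h2 := h.depth_par z (h.deepest_ne_root hz)
  exact h.ne_root_of_depth_pos (by omega)

theorem degree_of_depth_eq {c : V} (hc : d c = d z) : T.degree c = 1 := by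
  apply h.degree_eq_one_of_forall_ne h.sparse
  intro e he hec
  have h1 := hz e
  have h2 := h.depth_par e he
  rw [hec] at h2
  omega

theorem degree_par_deepest : T.degree (par z) = 2 ∧ 3 ≤ T.degree (par (par z)) := by
  refine h.degree_of_pendant_children h.sparse (h.deepest_ne_root hz) (h.par_deepest_ne_root hz) ?_
  intro c hc hcz
  have h1 := h.depth_par c hc
  have h2 := h.depth_par z (h.deepest_ne_root hz)
  rw [hcz] at h1
  exact h.degree_of_depth_eq hz (by omega)

/-- Exactly three quasi-pendant vertices lie outside `U`, and `q`, `w`, `par z` are three such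
vertices. -/
theorem isQuasiPendant_cases {v : V} (hv : T.IsQuasiPendant v) :
    v ∈ U ∨ v = q ∨ v = w ∨ v = par z := by
  have hd := h.degree_par_deepest hz
  have hw := h.three_le_degree
  have hzq : T.IsQuasiPendant (par z) :=
    ⟨z, h.adj_par (h.deepest_ne_root hz), h.degree_of_depth_eq hz rfl⟩
  have hzU : par z ∉ U := fun hzU =>
    (h.hanging _ hzU).2.2.1.1.2 (h.isQuasiPendant_of_three_le hd.2)
  have hqw : q ≠ w := by
    rintro rfl
    have h1 := h.depth_child
    have h2 := h.depth_grandchild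
    omega
  have hqz : q ≠ par z := by
    intro heq
    rw [← heq, h.par_child, h.degree_root] at hd
    omega
  have hwz : w ≠ par z := by
    intro heq
    rw [← heq] at hd
    omega
  have h3 : ({q, w, par z} : Finset V).card = 3 :=
    Finset.card_eq_three.2 ⟨q, w, par z, hqw, hqz, hwz, rfl⟩
  have hdisj : Disjoint U {q, w, par z} := by
    rw [Finset.disjoint_right]
    simp [h.child_notMem h.toIsHangingTransversal, h.grandchild_notMem h.toIsHangingTransversal,
      hzU]
  have heq : U ∪ {q, w, par z} = Finset.univ.filter T.IsQuasiPendant := by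
    apply Finset.eq_of_subset_of_card_le
    · intro v hv
      simp only [Finset.mem_union, Finset.mem_insert, Finset.mem_singleton] at hv
      simp only [Finset.mem_filter, Finset.mem_univ, true_and]
      rcases hv with hv | rfl | rfl | rfl
      · exact (h.hanging v hv).1
      · exact h.isQuasiPendant_child
      · exact h.isQuasiPendant_of_three_le hw
      · exact hzq
    · rw [Finset.card_union_of_disjoint hdisj, h3, h.card_quasi]
  have hmem : v ∈ Finset.univ.filter T.IsQuasiPendant := by simpa using hv
  rw [← heq] at hmem
  simpa only [Finset.mem_union, Finset.mem_insert, Finset.mem_singleton] using hmem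

theorem exists_child {v : V} (hv : T.degree v ≠ 1) (hvz : v ≠ par z) :
    ∃ c, c ≠ r ∧ par c = v ∧ T.degree c ≠ 1 := by
  rcases isInner_or_isQuasiPendant hv with hin | hq
  · obtain ⟨c, hc, hcv⟩ := h.exists_child_of_two_le_degree (hin.two_le_degree h.sparse)
    exact ⟨c, hc, hcv, hin.degree_ne_one_of_adj (hcv ▸ h.adj_par hc)⟩
  · rcases h.isQuasiPendant_cases hz hq with hU | rfl | rfl | rfl
    · refine h.sparse.exists_child_degree_ne_one h.toIsRooting hq ?_
      have h2 := hq.two_le_degree h.sparse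
      -- If `v` had degree 2, sparsity would force degree at least 3 on its parent, which has degree
      -- 2 by tightness.
      by_contra hlt
      obtain ⟨p, hp, hp1⟩ := hq
      have h1 := h.hanging v hU
      have h3 := h.sparse.three_le_degree p v (par v) hp hp1 (by omega) (h.adj_par h1.2.1) (by
        intro heq
        rw [← heq] at hp1
        exact h1.2.2.1.1.1 hp1)
      have := (h.degree_par hU).1
      omega
    · exact ⟨w, h.grandchild_ne, h.par_grandchild, by have := h.three_le_degree; omega⟩
    · exact h.sparse.exists_child_degree_ne_one h.toIsRooting hq h.three_le_degree
    · exact absurd rfl hvz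

/-- By `exists_child`, `par` maps the nonpendant vertices other than `q` onto a set containing all
nonpendant vertices other than `par z`. Both sets have the same size, so `par` is injective there.
-/
theorem par_injOn {u v : V} (hu : T.degree u ≠ 1) (hv : T.degree v ≠ 1) (huq : u ≠ q)
    (hvq : v ≠ q) (huv : par u = par v) : u = v := by
  set N := Finset.univ.filter fun v => T.degree v ≠ 1 with hN
  have hmem : ∀ v, v ∈ N ↔ T.degree v ≠ 1 := fun v => by simp [hN]
  have hsub : N.erase (par z) ⊆ (N.erase q).image par := by
    intro v hv
    rw [Finset.mem_erase, hmem] at hv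
    obtain ⟨c, hc, hcv, hc1⟩ := h.exists_child hz hv.2 hv.1
    refine Finset.mem_image.2 ⟨c, Finset.mem_erase.2 ⟨?_, (hmem c).2 hc1⟩, hcv⟩
    rintro rfl
    rw [← hcv, h.par_child] at hv
    exact hv.2 h.degree_root
  have hinj : Set.InjOn par (N.erase q : Finset V) := by
    rw [← Finset.card_image_iff]
    refine le_antisymm Finset.card_image_le ?_
    refine le_trans (le_of_eq ?_) (Finset.card_le_card hsub)
    rw [Finset.card_erase_of_mem, Finset.card_erase_of_mem]
    · rw [hmem]
      have := (h.degree_par_deepest hz).1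
      omega
    · rw [hmem]
      exact h.isQuasiPendant_child.degree_ne_one h.sparse
  exact hinj (by simp [hmem, hu, huq]) (by simp [hmem, hv, hvq]) huv

theorem eq_of_depth_eq {u v : V} (hu : T.degree u ≠ 1) (hv : T.degree v ≠ 1)
    (huv : d u = d v) : u = v := by
  have hne : ∀ u, T.degree u ≠ 1 → u ≠ r := fun u hu hur => hu (hur ▸ h.degree_root)
  induction hn : d u using Nat.strong_induction_on generalizing u v with
  | _ n ih =>
    have hur := hne u hu
    have hvr := hne v hv
    have h1 := h.depth_par u hur
    have h2 := h.depth_par v hvr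
    rcases Nat.lt_or_ge n 2 with hlt | hge
    · have hpu : par u = r := h.eq_root_of_depth_eq_zero (by omega)
      have hpv : par v = r := h.eq_root_of_depth_eq_zero (by omega)
      have hau := h.adj_par hur
      have hav := h.adj_par hvr
      rw [hpu] at hau
      rw [hpv] at hav
      exact eq_of_degree_eq_one h.degree_root hau.symm hav.symm
    · have hdq := h.depth_child
      refine h.par_injOn hz hu hv (by rintro rfl; omega) (by rintro rfl; omega) ?_
      refine ih (d (par u)) (by omega) (h.degree_par_ne_one hur ?_) (h.degree_par_ne_one hvr ?_)
        (by omega) rfl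
      · exact h.ne_root_of_depth_pos (by omega)
      · exact h.ne_root_of_depth_pos (by omega)

omit hz in
/-- Ancestors of `z` strictly between `z` and the root are not pendant. -/
theorem degree_iterate_ne_one {i : ℕ} (hi : 0 < i) (hiz : i < d z) :
    T.degree (par^[d z - i] z) ≠ 1 := by
  obtain ⟨j, hj⟩ : ∃ j, d z - i = j + 1 := ⟨d z - i - 1, by omega⟩
  have h1 := h.depth_iterate (v := z) (k := j) (by omega)
  have h2 := h.depth_iterate (v := z) (k := j + 1) (by omega)
  rw [hj]
  rw [Function.iterate_succ_apply'] at h2 ⊢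
  exact h.degree_par_ne_one (h.ne_root_of_depth_pos (by omega)) (h.ne_root_of_depth_pos (by omega))

/-- The nonpendant vertices occupy each depth from 1 to `d z - 1` exactly once, and there are `3 *
U.card + 3` of them. -/
theorem depth_deepest : d z = 3 * U.card + 4 := by
  set N := Finset.univ.filter fun v => T.degree v ≠ 1 with hN
  have hmem : ∀ v, v ∈ N ↔ T.degree v ≠ 1 := fun v => by simp [hN]
  have himg : N.image d = Finset.Ico 1 (d z) := by
    ext i
    rw [Finset.mem_image, Finset.mem_Ico]
    constructor
    · rintro ⟨v, hv, rfl⟩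
      rw [hmem] at hv
      refine ⟨h.depth_pos fun hvr => hv (hvr ▸ h.degree_root), ?_⟩
      exact lt_of_le_of_ne (hz v) fun heq => hv (h.degree_of_depth_eq hz heq)
    · rintro ⟨h1, h2⟩
      refine ⟨_, (hmem _).2 (h.degree_iterate_ne_one h1 h2), ?_⟩
      have := h.depth_iterate (v := z) (k := d z - i) (by omega)
      omega
  have hcard := Finset.card_image_of_injOn (s := N) (f := d) fun u hu v hv huv =>
    h.eq_of_depth_eq hz ((hmem u).1 hu) ((hmem v).1 hv) huv
  rw [himg, Nat.card_Ico, h.card_nonpendant] at hcard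
  omega

/-- Along the spine, the vertex following a quasi-pendant one is inner and, having a quasi-pendant
parent, must be a grandparent of some `a ∈ U`. Thus `a` is the quasi-pendant spine vertex three
levels further down. -/
theorem isQuasiPendant_iterate {i : ℕ} (hi : i ≤ U.card) :
    T.IsQuasiPendant (par^[d z - (3 * i + 2)] z) := by
  have hD := h.depth_deepest hz
  have hdep : ∀ i, i ≤ d z → d (par^[d z - i] z) = i := fun i hi => by
    have := h.depth_iterate (v := z) (k := d z - i) (by omega)
    omega
  have huniq : ∀ v, T.degree v ≠ 1 → 0 < d v → d v < d z → par^[d z - d v] z = v :=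
    fun v hv h0 h1 => h.eq_of_depth_eq hz (h.degree_iterate_ne_one h0 h1) hv (hdep _ h1.le)
  induction i with
  | zero =>
    have h1 := huniq w (by have := h.three_le_degree; omega)
    rw [h.depth_grandchild] at h1
    rw [h1 (by omega) (by omega)]
    exact h.isQuasiPendant_of_three_le h.three_le_degree
  | succ i ih =>
    have hpq := ih (by omega)
    set v := par^[d z - (3 * i + 3)] z with hv
    have hpv : par v = par^[d z - (3 * i + 2)] z := by
      rw [hv, ← Function.iterate_succ_apply' par]
      congr 1
      omega
    rw [← hpv] at hpq
    have hdv : d v = 3 * i + 3 := hdep _ (by omega)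
    have hv1 : T.degree v ≠ 1 := h.degree_iterate_ne_one (by omega) (by omega)
    rcases isInner_or_isQuasiPendant hv1 with hin | hq
    · rcases h.isInner_cases hin with ⟨a, ha, hav⟩ | ⟨a, ha, hav⟩
      · have := (h.hanging a ha).2.2.2
        rw [hav] at this
        exact absurd hpq this.2
      · have hh := h.hanging a ha
        have h1 := h.depth_par a hh.2.1
        have h2 := h.depth_par (par a) (hh.2.2.1.1.ne_root h.degree_root)
        rw [hav] at h2
        have h3 := huniq a (hh.1.degree_ne_one h.sparse) (by omega) (by omega)
        rw [show d a = 3 * (i + 1) + 2 by omega] at h3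
        rw [h3]
        exact hh.1
    · exfalso
      rcases h.isQuasiPendant_cases hz hq with hU | heq | heq | heq
      · exact (h.hanging v hU).2.2.1.1.2 hpq
      · have := h.depth_child
        rw [← heq] at this
        omega
      · have := h.depth_grandchild
        rw [← heq] at this
        omega
      · have := h.depth_par z (h.deepest_ne_root hz)
        rw [← heq] at this
        omega

theorem nonempty_iso_of_deepest (hcard : Fintype.card V = 4 * U.card + 6) :
    Nonempty (T ≃g extremalTree (U.card + 1)) := by
  have hD := h.depth_deepest hz
  set s : ℕ → V := fun i => par^[d z - i] z with hs
  have hsd : ∀ i, i ≤ d z → d (s i) = i := fun i hi => by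
    have := h.depth_iterate (v := z) (k := d z - i) (by omega)
    simp only [hs]
    omega
  have hspar : ∀ i, i + 1 ≤ d z → par (s (i + 1)) = s i := fun i hi => by
    simp only [hs]
    rw [← Function.iterate_succ_apply' par]
    congr 1
    omega
  have hs1 : ∀ i, 0 < i → i < d z → T.degree (s i) ≠ 1 := fun i =>
    h.degree_iterate_ne_one
  have hs0 : s 0 = r := h.eq_root_of_depth_eq_zero (hsd 0 (by omega))
  have hsz : s (d z) = z := by simp [hs]
  have hex : ∀ i : Fin (U.card + 1), ∃ y, T.Adj y (s (3 * i + 2)) ∧ T.degree y = 1 :=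
    fun i => h.isQuasiPendant_iterate hz (by omega)
  choose y hy hy1 using hex
  have hyr : ∀ i, y i ≠ r ∧ par (y i) = s (3 * i + 2) := by
    intro i
    refine h.child_of_adj (hy i) (Or.inr fun heq => ?_)
    rw [show (3 * (i : ℕ) + 2) = (3 * i + 1) + 1 by ring, hspar _ (by omega)] at heq
    exact hs1 (3 * i + 1) (by omega) (by omega) (heq ▸ hy1 i)
  have hys : ∀ i j, j ≤ d z → y i ≠ s j := by
    intro i j hj heq
    rcases Nat.eq_zero_or_pos j with rfl | hj0
    · exact (hyr i).1 (heq.trans hs0)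
    · rcases hj.lt_or_eq with hlt | rfl
      · exact hs1 j hj0 hlt (heq ▸ hy1 i)
      -- If `y i` were `z`, its parent would have depth both `3 * i + 2` and `3 * U.card + 3`,
      -- impossible modulo 3.
      · have h1 := (hyr i).2
        rw [heq, show d z = (3 * U.card + 3) + 1 by omega, hspar _ (by omega)] at h1
        have h2 := hsd (3 * U.card + 3) (by omega)
        rw [h1, hsd _ (by omega)] at h2
        omega
  refine h.nonempty_iso_extremalTree (Sum.elim (fun a => s a) y) ?_ hs0 ?_
  · rw [Fintype.bijective_iff_injective_and_card]
    constructor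
    · rintro (a | i) (b | j) hab
      · have h1 := hsd a (by omega)
        have h2 := hsd b (by omega)
        simp only [Sum.elim_inl] at hab
        rw [hab] at h1
        exact congrArg Sum.inl (Fin.ext (by omega))
      · exact absurd hab.symm (hys j a (by omega))
      · exact absurd hab (hys i b (by omega))
      · have h1 := hsd (3 * i + 2) (by omega)
        have h2 := hsd (3 * j + 2) (by omega)
        simp only [Sum.elim_inr] at hab
        rw [← (hyr i).2, hab, (hyr j).2] at h1
        exact congrArg Sum.inr (Fin.ext (by omega))
    · simp only [Fintype.card_sum, Fintype.card_fin]
      omega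
  · rintro (a | i) ha
    · have ha0 : (a : ℕ) ≠ 0 := fun h0 => ha (congrArg Sum.inl (Fin.ext h0))
      simp only [extremalPar, Sum.elim_inl]
      rw [← hspar (a - 1) (by omega)]
      congr 2
      omega
    · simpa [extremalPar] using (hyr i).2

end Deepest

theorem nonempty_iso (hcard : Fintype.card V = 4 * U.card + 6) :
    Nonempty (T ≃g extremalTree (U.card + 1)) := by
  obtain ⟨z, -, hz⟩ := Finset.exists_max_image Finset.univ d ⟨r, Finset.mem_univ r⟩
  exact h.nonempty_iso_of_deepest (fun v => hz v (Finset.mem_univ v)) hcard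

end IsTight

theorem nonempty_iso_of_card_eq [DecidableEq V] (hT : T.IsTree) (hn : 4 ≤ Fintype.card V)
    (hred : IsReducedGraph T) (hP : ¬ HasPendantPath T 3)
    (hm : Fintype.card V = 4 * laplacianMultiplicity T 1 + 6) :
    ∃ k : ℕ, 1 ≤ k ∧ Nonempty (T ≃g extremalTree k) := by
  have hs := pendantSparse_of_isReducedGraph hT.connected hn hred hP
  obtain ⟨r, par, d, q, w, h⟩ := exists_isPendantRoot hT hs (by omega)
  obtain ⟨U, hU⟩ := T.exists_isHangingTransversal r par
  have h1 := h.laplacianMultiplicity_le_card hs h.degree_root hU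
  have h2 := h.card_add_three_le hs hU
  have h3 := hU.two_mul_card_le h.degree_root
  have h4 := card_eq_of_isReducedGraph hs hred
  have ht : T.IsTight r par d q w U :=
    { h, hU with
      sparse := hs
      mult := by omega
      card_inner := by omega
      card_quasi := by omega }
  exact ⟨U.card + 1, by omega, ht.nonempty_iso (by omega)⟩

end SimpleGraph

/-! ### Eigenvectors of the extremal tree -/

namespace SimpleGraph

theorem isOneHarmonic_iff_sum_ite {V : Type*} [Fintype V] {T : SimpleGraph V} [DecidableRel T.Adj]
    {x : V → ℝ} :
    T.IsOneHarmonic x ↔ ∀ v, ∑ u, (if T.Adj v u then x v - x u else 0) = x v := by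
  refine forall_congr' fun v => ?_
  have h1 : ∑ u, (if T.Adj v u then x v - x u else 0) =
      T.degree v * x v - ∑ u ∈ T.neighborFinset v, x u := by
    rw [← Finset.sum_filter, ← T.neighborFinset_eq_filter, Finset.sum_sub_distrib,
      Finset.sum_const, T.card_neighborFinset_eq_degree, nsmul_eq_mul]
  rw [h1]
  constructor <;> intro h <;> linarith

/-- The vector on the extremal tree with value `a j` at the spine vertices `3j` and `3j + 1` and
value `0` at the remaining spine vertices. -/
def extremalVector (k : ℕ) : (ℕ → ℝ) →ₗ[ℝ] (Fin (3 * k + 2) ⊕ Fin k → ℝ) where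
  toFun a := Sum.elim (fun b => if b.val % 3 = 2 then 0 else a (b.val / 3))
    (fun i => -(a i.val + a (i.val + 1)))
  map_add' a b := by
    funext t
    rcases t with t | t
    · simp only [Sum.elim_inl, Pi.add_apply]
      split_ifs <;> simp
    · simp only [Sum.elim_inr, Pi.add_apply]
      ring
  map_smul' c a := by
    funext t
    rcases t with t | t
    · simp
    · simp only [Sum.elim_inr, Pi.smul_apply, smul_eq_mul, RingHom.id_apply]
      ring

theorem sum_range_ite_succ_or (g : ℕ → ℝ) {b N : ℕ} (hb : b < N) :
    ∑ j ∈ Finset.range N, (if b + 1 = j ∨ j + 1 = b then g j else 0) =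
      (if b + 1 < N then g (b + 1) else 0) + (if 0 < b then g (b - 1) else 0) := by
  have h1 : ∀ j, (if b + 1 = j ∨ j + 1 = b then g j else 0) =
      (if b + 1 = j then g j else 0) + (if j + 1 = b then g j else 0) := by
    intro j
    by_cases h2 : b + 1 = j
    · have h3 : ¬ j + 1 = b := by omega
      simp [h2, h3]
    · simp [h2]
  simp only [h1]
  rw [Finset.sum_add_distrib, Finset.sum_ite_eq]
  simp only [Finset.mem_range]
  congr 1
  rcases b with _ | b
  · simp
  · have : b ∈ Finset.range N := Finset.mem_range.2 (by omega)
    simp only [Nat.add_right_cancel_iff, Finset.sum_ite_eq', this, if_true, Nat.succ_pos,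
      Nat.add_sub_cancel]

theorem sum_fin_ite_eq_three_mul_add_two (g : ℕ → ℝ) {b k : ℕ} (hb : b < 3 * k + 2) :
    ∑ i : Fin k, (if b = 3 * i.val + 2 then g i else 0) =
      if b % 3 = 2 then g (b / 3) else 0 := by
  rw [Fin.sum_univ_eq_sum_range (fun i => if b = 3 * i + 2 then g i else 0) k]
  by_cases hb2 : b % 3 = 2
  · rw [if_pos hb2, Finset.sum_eq_single_of_mem (b / 3) (Finset.mem_range.2 (by omega)),
      if_pos (by omega)]
    intro j _ hj
    exact if_neg (by omega)
  · rw [if_neg hb2]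
    exact Finset.sum_eq_zero fun j _ => if_neg (by omega)

open Classical in
-- The conditions `a 0 = 0` and `a k = 0` are the equations at the two ends of the spine. The value
-- $-(a_i+a_{i+1})$ on an extra vertex balances its quasi-pendant neighbour, and the other equations
-- hold automatically.
theorem sum_ite_extremalVector (k : ℕ) (a : ℕ → ℝ) (h0 : a 0 = 0) (hk : a k = 0)
    (t : Fin (3 * k + 2) ⊕ Fin k) :
    ∑ s, (if (extremalTree k).Adj t s then extremalVector k a t - extremalVector k a s else 0) =
      extremalVector k a t := by
  rw [Fintype.sum_sum_type]
  set F : ℕ → ℝ := fun b => if b % 3 = 2 then 0 else a (b / 3) with hF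
  set Y : ℕ → ℝ := fun i => -(a i + a (i + 1)) with hY
  have hinl : ∀ b, extremalVector k a (.inl b) = F b := fun b => rfl
  have hinr : ∀ i, extremalVector k a (.inr i) = Y i := fun i => rfl
  have hF0 : ∀ j, F (3 * j) = a j := fun j => by
    simp only [hF]
    rw [if_neg (by omega)]
    congr 1
    omega
  have hF1 : ∀ j, F (3 * j + 1) = a j := fun j => by
    simp only [hF]
    rw [if_neg (by omega)]
    congr 1
    omega
  have hF2 : ∀ j, F (3 * j + 2) = 0 := fun j => if_pos (by omega)
  rcases t with b | i
  · have hll : ∀ c : Fin (3 * k + 2), (extremalTree k).Adj (.inl b) (.inl c) ↔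
        b.val + 1 = c.val ∨ c.val + 1 = b.val := fun c => pathGraph_adj
    have hlr : ∀ i : Fin k, (extremalTree k).Adj (.inl b) (.inr i) ↔ b.val = 3 * i.val + 2 :=
      fun i => Iff.rfl
    simp only [hll, hlr, hinl, hinr]
    rw [Fin.sum_univ_eq_sum_range
        (fun j => if b.val + 1 = j ∨ j + 1 = b.val then F b.val - F j else 0),
      sum_range_ite_succ_or _ b.2,
      sum_fin_ite_eq_three_mul_add_two (fun i => F b.val - Y i) b.2]
    obtain ⟨b, hb⟩ := b
    simp only
    obtain ⟨j, hj | hj | hj⟩ : ∃ j, b = 3 * j ∨ b = 3 * j + 1 ∨ b = 3 * j + 2 :=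
      ⟨b / 3, by omega⟩
    · subst hj
      rw [if_pos (by omega), if_neg (by omega : ¬ 3 * j % 3 = 2), hF0, hF1]
      rcases j with _ | j
      · simp [h0]
      · rw [if_pos (by omega), show 3 * (j + 1) - 1 = 3 * j + 2 by omega, hF2]
        ring
    · subst hj
      rw [if_pos (by omega : 0 < 3 * j + 1), if_neg (by omega : ¬ (3 * j + 1) % 3 = 2),
        Nat.add_sub_cancel, hF0, hF1, hF2]
      by_cases hjk : j = k
      · subst hjk
        simp [hk]
      · rw [if_pos (by omega)]
        ring
    · subst hj
      rw [if_pos (by omega), if_pos (by omega), if_pos (by omega), hF2,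
        show 3 * j + 2 + 1 = 3 * (j + 1) by ring, hF0, show 3 * j + 2 - 1 = 3 * j + 1 by omega, hF1,
        show (3 * j + 2) / 3 = j by omega, hY]
      ring
  · have hrl : ∀ c : Fin (3 * k + 2), (extremalTree k).Adj (.inr i) (.inl c) ↔
        c.val = 3 * i.val + 2 := fun c => Iff.rfl
    have hrr : ∀ j : Fin k, ¬ (extremalTree k).Adj (.inr i) (.inr j) := fun j => id
    simp only [hrl, hrr, hinl, hinr, if_false, Finset.sum_const_zero, add_zero]
    rw [Fin.sum_univ_eq_sum_range (fun c => if c = 3 * i.val + 2 then Y i.val - F c else 0),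
      Finset.sum_ite_eq', if_pos (Finset.mem_range.2 (by omega)), hF2, sub_zero]

/-- Extension by zero of a vector indexed by `0, …, m - 1`, shifted by one. -/
def extendShift (m : ℕ) : (Fin m → ℝ) →ₗ[ℝ] (ℕ → ℝ) where
  toFun c i := if h : 0 < i ∧ i ≤ m then c ⟨i - 1, by omega⟩ else 0
  map_add' c c' := by
    funext i
    simp only [Pi.add_apply]
    split_ifs <;> simp
  map_smul' s c := by
    funext i
    simp

theorem le_laplacianMultiplicity_of_iso {V : Type*} [Fintype V] [DecidableEq V]
    {T : SimpleGraph V} [DecidableRel T.Adj] {m : ℕ} (e : T ≃g extremalTree (m + 1)) :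
    m ≤ laplacianMultiplicity T 1 := by
  classical
  set L : (Fin m → ℝ) →ₗ[ℝ] (V → ℝ) :=
    (LinearMap.funLeft ℝ ℝ e).comp ((extremalVector (m + 1)).comp (extendShift m)) with hL
  have hmem : ∀ c, L c ∈ Module.End.eigenspace (Matrix.toLin' (T.lapMatrix ℝ)) 1 := by
    intro c
    rw [mem_eigenspace_lapMatrix_one]
    refine isOneHarmonic_iff_sum_ite.2 fun v => ?_
    have h1 := sum_ite_extremalVector (m + 1) (extendShift m c) (by simp [extendShift])
      (by simp [extendShift]) (e v)
    rw [← Equiv.sum_comp e.toEquiv] at h1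
    refine Eq.trans ?_ h1
    refine Finset.sum_congr rfl fun u _ => ?_
    exact if_congr e.map_adj_iff.symm rfl rfl
  rw [laplacianMultiplicity_eq_finrank]
  have hinj : Function.Injective (L.codRestrict _ hmem) := by
    rw [injective_iff_map_eq_zero]
    intro c hc
    have hc' : L c = 0 := congrArg Subtype.val hc
    funext j
    -- The spine vertex $3(j+1)$ carries exactly the coordinate `c j`.
    have h1 := congrFun hc' (e.symm (.inl ⟨3 * (j.val + 1), by omega⟩))
    have h2 : L c (e.symm (.inl ⟨3 * (j.val + 1), by omega⟩)) =
        extremalVector (m + 1) (extendShift m c) (.inl ⟨3 * (j.val + 1), by omega⟩) := by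
      simp [hL, LinearMap.funLeft_apply]
    rw [h2] at h1
    simpa [extremalVector, extendShift] using h1
  simpa using LinearMap.finrank_le_finrank_of_injective hinj

end SimpleGraph

theorem theorem2 {V : Type*} [Fintype V] [DecidableEq V] (T : SimpleGraph V) [DecidableRel T.Adj]
    (hT : T.IsTree) (hn : 6 ≤ Fintype.card V) (hred : IsReducedGraph T) (hP : ¬ HasPendantPath T 3) :
    (laplacianMultiplicity T 1 : ℝ) ≤ ((Fintype.card V : ℝ) - 6) / 4 ∧
      ((laplacianMultiplicity T 1 : ℝ) = ((Fintype.card V : ℝ) - 6) / 4 ↔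
        ∃ k : ℕ, 1 ≤ k ∧ Nonempty (T ≃g extremalTree k)) := by
  have hle := SimpleGraph.four_mul_laplacianMultiplicity_add_six_le hT (by omega) hred hP
  have hle' : (4 : ℝ) * laplacianMultiplicity T 1 + 6 ≤ Fintype.card V := by exact_mod_cast hle
  refine ⟨by linarith, fun heq => ?_, ?_⟩
  · apply SimpleGraph.nonempty_iso_of_card_eq hT (by omega) hred hP
    have h1 : (Fintype.card V : ℝ) = 4 * laplacianMultiplicity T 1 + 6 := by linarith
    exact_mod_cast h1
  · rintro ⟨k, hk, ⟨e⟩⟩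
    obtain ⟨m, rfl⟩ := Nat.exists_eq_add_of_le' hk
    have h1 := SimpleGraph.le_laplacianMultiplicity_of_iso e
    have h2 := Fintype.card_congr e.toEquiv
    simp only [Fintype.card_sum, Fintype.card_fin] at h2
    have h3 : laplacianMultiplicity T 1 = m := by omega
    have h4 : Fintype.card V = 4 * m + 6 := by omega
    rw [h3, h4]
    push_cast
    ring
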